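/- **Models of $T_0$.** A model of $T_0$ is a pair $(M,d_N)$, where $M$ is a real Hilbert space (of any dimension) and $d_N:M\to[0,1]$ satisfies 1. for all $x\in M$: $\min\{\max(1-d_N(x),0),\ \inf_{y\in M}\max\{|d_N(x)-\|x-y\||,\,d_N(y)\}\}=0$; 2. for all $x,y\in M$: $d_N(y)-\|x-y\|-d_N(x)\le 0$. We write $(M,d_N)\subset(H,d_N')$ if $M$ is a closed subspace of $H$ and $d_N'|_M=d_N$. A model $(M,d_N)$ of $T_0$ is *existentially closed* if for every model $(H,d_N')\supset(M,d_N)$ of $T_0$, every quantifier-free formula $\varphi(\bar x,\bar v)$ of continuous logic in the language of Hilbert spaces with $d_N$, all parameters $\bar a$ in $M$, and every choice of balls of positive integer radius (about $0$) for the variables $\bar x$ to range over, $\inf_{\bar x}\varphi(\bar x,\bar a)$ has the same value in $M$ and in $H$. **Locus formulas.** Let $n,k\ge 0$ and let $L\ge1$ be an integer. A *configuration* consists of models $(M,d_N)\subset(M_1,d_N^1)$ of $T_0$, tuples $\bar x=(x_1,\dots,x_{n+k})$ and $\bar y=(y_1,\dots,y_n)$ in $M_1\setminus M$, of norms $\le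 L$, with orthogonal projections $\bar z=(z_1,\dots,z_{n+k})$ and $\bar u=(u_1,\dots,u_n)$ on $M$, such that $d_N^1(y_i)=0$ and $d^1_N(x_i)=\|x_i-y_i\|$ for $i\le n$, and $d_N^1(x_i)^2=\|x_i-z_i\|^2+d_N(z_i)^2$ for $i>n$. If $G$ is the matrix of inner products of the concatenation $(\bar x,\bar y,\bar z,\bar u)$ of a configuration, a *geometric locus formula* for $G$ is $\varphi(\bar t)=F\big((\langle t_p,t_q\rangle)_{p,q}\big)$, where $F\ge 0$ is a continuous real function of matrices that vanishes exactly at $G$ (for example $\varphi(\bar t)=\max_{p,q}|\langle t_p,t_q\rangle-G_{pq}|$). For $\varepsilon\in(0,1)$, a continuous $f:[0,1]\to[0,1]$ is *admissible* for $(\varphi,L,\varepsilon)$ if, for every tuple $\bar t=(\bar x,\bar y,\bar z,\bar u)$ of vectors of norm $\le L+1$ in a Hilbert space with $\varphi(\bar t)<f(\varepsilon)$ and every tuple $\bar t'$ in a Hilbert space with $\varphi(\bar t')=0$: $\|P_{\mathrm{span}(\bar z\bar u)}(x_i)-z_i\|<\varepsilon$ and $\|P_{\mathrm{span}(\bar z\bar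 u)}(y_i)-u_i\|<\varepsilon$ for all $i$, $\big|\|t_p-t_q\|-\|t'_p-t'_q\|\big|<\varepsilon$ for all $p,q$, and $\|t_p\|\le L+\varepsilon$ for all $p$. **The theory $T_N$.** For $G$, $L$, $\varphi$ as above, $\varepsilon\in(0,1)\cap\mathbb Q$ and $f$ admissible for $(\varphi,L,\varepsilon)$, put $\delta=2\sqrt{\varepsilon(L+2)}$. The axiom $\psi_{\varphi,\varepsilon}$ says the following, where all quantifiers range over the ball of radius $L+1$. For all $\bar z,\bar u$, (A) or (B) holds: (A) for all $\bar x,\bar y$, at least one of the following holds: - $\varphi(\bar x,\bar y,\bar z,\bar u)\ge f(\varepsilon)$; - there are $w$ and $i\le n$ with $d_N(w)^2\ge\|w-u_i\|^2+\|y_i-u_i\|^2+\varepsilon^2$; - $\|x_i-y_j\|^2\le\|x_i-z_i\|^2+d_N(z_i)^2+\varepsilon^2$ for some $i>n$, $j\le n$; - $\|x_i-y_j\|\le\|x_i-y_i\|-\varepsilon$ for some $i,j\le n$, $j\ne i$; - $\|x_i-z_i\|^2+d_N(z_i)^2\le\|x_i-y_i\|^2-\varepsilon^2$ for some $i\le n$;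 (B) there are $\bar x,\bar y$ such that - $\varphi(\bar x,\bar y,\bar z,\bar u)\le f(\varepsilon)$; - $d_N(y_i)\le\delta$ and $\big|d_N(x_i)-\|x_i-y_i\|\big|\le2\delta$ for $i\le n$; - $\big|d_N(x_i)^2-\min\{1,\ \|x_i-z_i\|^2+d_N(z_i)^2\}\big|\le4\delta L$ for $i>n$. $(M,d_N)\models T_N$ means that $(M,d_N)$ is a model of $T_0$ and satisfies $\psi_{\varphi,\varepsilon}$ for all such $G,L,\varphi,\varepsilon,f$. **Theorem.** If $(M,d_N)\models T_0$ is existentially closed, then $(M,d_N)\models T_N$. -/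

import Mathlib

open scoped RealInnerProductSpace

noncomputable section

namespace GenericHilbert

universe u

/-! ### The theory `T₀` and extensions -/

/-- `(M, d)` is a model of `T₀`: `M` is a real Hilbert space (finite-dimensional ones included)
and `d : M → [0,1]` satisfies the two axioms of a distance to a subset, truncated at one.
A supremum of values is stated by a universal quantifier. The infimum in `ax_witness` is over all
of `M`; it is bounded below by `0`. -/
structure ModelsT0 {M : Type u} [NormedAddCommGroup M] [InnerProductSpace ℝ M] [CompleteSpace M]
    (d : M → ℝ) : Prop where
  nonneg : ∀ x, 0 ≤ d x
  le_one : ∀ x, d x ≤ 1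
  ax_witness : ∀ x, min (max (1 - d x) 0) (⨅ y, max |d x - ‖x - y‖| (d y)) = 0
  ax_lipschitz : ∀ x y, d y - ‖x - y‖ - d x ≤ 0

/-- `(M, d) ⊂ (H, d')` via the linear isometric embedding `e`. -/
def IsExtension {M H : Type u} [NormedAddCommGroup M] [InnerProductSpace ℝ M]
    [NormedAddCommGroup H] [InnerProductSpace ℝ H]
    (d : M → ℝ) (d' : H → ℝ) (e : M →ₗᵢ[ℝ] H) : Prop :=
  ∀ x, d' (e x) = d x

/-! ### Quantifier-free formulas of continuous logic and existentially closed models -/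

/-- Terms of the language of real Hilbert spaces, with variables in `V`. -/
inductive HTerm (V : Type) : Type
  | var : V → HTerm V
  | zero : HTerm V
  | add : HTerm V → HTerm V → HTerm V
  | smul : ℝ → HTerm V → HTerm V

/-- Quantifier-free formulas of continuous logic in the language of Hilbert spaces together with
the predicate `d_N`. All continuous functions serve as connectives. -/
inductive QFFormula (V : Type) : Type
  | inner : HTerm V → HTerm V → QFFormula V
  | dist : HTerm V → HTerm V → QFFormula V
  | dN : HTerm V → QFFormula V
  | conn : (k : ℕ) → C((Fin k → ℝ), ℝ) → (Fin k → QFFormula V) → QFFormula V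

section Semantics

variable {V : Type} {M : Type u} [NormedAddCommGroup M] [InnerProductSpace ℝ M]

/-- The interpretation of a term under the assignment `v`. -/
def HTerm.eval (v : V → M) : HTerm V → M
  | .var a => v a
  | .zero => 0
  | .add s t => s.eval v + t.eval v
  | .smul r t => r • t.eval v

/-- The value of a quantifier-free formula in `(M, d)` under the assignment `v`. -/
def QFFormula.eval (d : M → ℝ) (v : V → M) : QFFormula V → ℝ
  | .inner s t => ⟪s.eval v, t.eval v⟫
  | .dist s t => ‖s.eval v - t.eval v‖
  | .dN t => d (t.eval v)
  | .conn _ g φ => g (fun i => (φ i).eval d v)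

end Semantics

/-- `(M, d)` is an existentially closed model of `T₀`: for every model `(H, d')` of `T₀` extending
`(M, d)`, every quantifier-free formula `φ(x̄, v̄)`, all parameters `a` in `M` and every choice of
sorts for `x̄` (balls whose radii `R i` are positive integers),
`inf_x̄ φ(x̄, a)` computed in `M` is at most (hence equals) `inf_x̄ φ(x̄, a)` computed in `H`. -/
def IsExistentiallyClosedT0 {M : Type u} [NormedAddCommGroup M] [InnerProductSpace ℝ M]
    [CompleteSpace M] (d : M → ℝ) : Prop :=
  ModelsT0 d ∧
  ∀ (H : Type u) [NormedAddCommGroup H] [InnerProductSpace ℝ H] [CompleteSpace H]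
    (d' : H → ℝ) (e : M →ₗᵢ[ℝ] H), ModelsT0 d' → IsExtension d d' e →
  ∀ (m l : ℕ) (φ : QFFormula (Fin m ⊕ Fin l)) (a : Fin l → M) (R : Fin m → ℕ), (∀ i, 0 < R i) →
  ∀ b : Fin m → H, (∀ i, ‖b i‖ ≤ R i) →
  ∀ η : ℝ, 0 < η → ∃ b' : Fin m → M, (∀ i, ‖b' i‖ ≤ R i) ∧
    φ.eval d (Sum.elim b' a) < φ.eval d' (Sum.elim b (e ∘ a)) + η

/-! ### Configurations and geometric locus formulas

An index `i ≤ n` is an element of `Fin n` (on the left of `Fin n ⊕ Fin k`), an index `i > n` is an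
element of `Fin k` (on the right). -/

/-- The index type of the concatenation of `x̄, ȳ, z̄, ū`, tuples of lengths `n+k, n, n+k, n`. -/
abbrev Idx (n k : ℕ) : Type := (Fin n ⊕ Fin k) ⊕ Fin n ⊕ (Fin n ⊕ Fin k) ⊕ Fin n

/-- The concatenation of `x̄, ȳ, z̄, ū`. -/
def concat {n k : ℕ} {E : Type u} (x : Fin n ⊕ Fin k → E) (y : Fin n → E)
    (z : Fin n ⊕ Fin k → E) (w : Fin n → E) : Idx n k → E :=
  Sum.elim x (Sum.elim y (Sum.elim z w))

/-- The matrix of inner products of a tuple. -/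
def gramOf {n k : ℕ} {E : Type u} [NormedAddCommGroup E] [InnerProductSpace ℝ E]
    (t : Idx n k → E) : Idx n k → Idx n k → ℝ :=
  fun p q => ⟪t p, t q⟫

/-- `φ(t̄) = F(⟨t_p, t_q⟩)_{p,q}` is a geometric locus formula for `G`: a continuous, nonnegative
function of the inner products such that `φ(t̄) = 0` says that the inner products are given by `G`.
The standard example is `φ(t̄) = max_{p,q} |⟨t_p, t_q⟩ - G_{p,q}|`. -/
structure IsLocusFormula {n k : ℕ} (G : Idx n k → Idx n k → ℝ)
    (F : (Idx n k → Idx n k → ℝ) → ℝ) : Prop where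
  continuous : Continuous F
  nonneg : ∀ A, 0 ≤ F A
  eq_zero_iff : ∀ A, F A = 0 ↔ A = G

/-- The tuples `x̄, ȳ` of `(M₁, d₁) ⊃ (M, d)` lie outside `M` and in the ball of radius `L`,
`z̄, ū` are their projections on `M`, each `y_i` is a black point which witnesses the distance of
`x_i` for `i ≤ n`, and the distance of `x_i` for `i > n` is witnessed in `M`. -/
structure IsConfiguration {n k : ℕ} (L : ℕ) {M M₁ : Type u}
    [NormedAddCommGroup M] [InnerProductSpace ℝ M]
    [NormedAddCommGroup M₁] [InnerProductSpace ℝ M₁]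
    (d : M → ℝ) (d₁ : M₁ → ℝ) (e : M →ₗᵢ[ℝ] M₁)
    (x : Fin n ⊕ Fin k → M₁) (y : Fin n → M₁)
    (z : Fin n ⊕ Fin k → M) (w : Fin n → M) : Prop where
  x_new : ∀ i, x i ∉ Set.range e
  y_new : ∀ i, y i ∉ Set.range e
  x_bdd : ∀ i, ‖x i‖ ≤ L
  y_bdd : ∀ i, ‖y i‖ ≤ L
  x_proj : ∀ i, ∀ m : M, ⟪x i - e (z i), e m⟫ = 0
  y_proj : ∀ i, ∀ m : M, ⟪y i - e (w i), e m⟫ = 0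
  y_black : ∀ i, d₁ (y i) = 0
  x_left : ∀ i : Fin n, d₁ (x (.inl i)) = ‖x (.inl i) - y i‖
  x_right : ∀ i : Fin k,
    d₁ (x (.inr i)) ^ 2 = ‖x (.inr i) - e (z (.inr i))‖ ^ 2 + d (z (.inr i)) ^ 2

/-- `G` is the matrix of inner products of a configuration inside the ball of radius `L`, in some
extension of models of `T₀`. -/
def IsLocus.{v} {n k : ℕ} (L : ℕ) (G : Idx n k → Idx n k → ℝ) : Prop :=
  ∃ (M M₁ : Type v) (_ : NormedAddCommGroup M) (_ : InnerProductSpace ℝ M) (_ : CompleteSpace M)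
    (_ : NormedAddCommGroup M₁) (_ : InnerProductSpace ℝ M₁) (_ : CompleteSpace M₁)
    (d : M → ℝ) (d₁ : M₁ → ℝ) (e : M →ₗᵢ[ℝ] M₁)
    (x : Fin n ⊕ Fin k → M₁) (y : Fin n → M₁) (z : Fin n ⊕ Fin k → M) (w : Fin n → M),
    ModelsT0 d ∧ ModelsT0 d₁ ∧ IsExtension d d₁ e ∧ IsConfiguration L d d₁ e x y z w ∧
    G = gramOf (concat x y (e ∘ z) (e ∘ w))

/-- The subspace spanned by `z̄, ū`. -/
def paramSpan {n k : ℕ} {E : Type u} [NormedAddCommGroup E] [InnerProductSpace ℝ E]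
    (z : Fin n ⊕ Fin k → E) (w : Fin n → E) : Submodule ℝ E :=
  Submodule.span ℝ (Set.range z ∪ Set.range w)

instance {n k : ℕ} {E : Type u} [NormedAddCommGroup E] [InnerProductSpace ℝ E]
    (z : Fin n ⊕ Fin k → E) (w : Fin n → E) : FiniteDimensional ℝ (paramSpan z w) :=
  FiniteDimensional.span_of_finite ℝ ((Set.finite_range z).union (Set.finite_range w))

/-- All entries of the tuple `t` lie in the ball of radius `r` around `0`. -/
def InBall {I : Type} {E : Type u} [NormedAddCommGroup E] (r : ℝ) (t : I → E) : Prop :=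
  ∀ i, ‖t i‖ ≤ r

/-- The requirement on the continuous function `f : [0,1] → [0,1]` at `ε`, for the formula `φ`
given by `F`: whenever `φ(t̄) < f(ε)` and `φ(t̄') = 0`, where `t̄ = (x̄, ȳ, z̄, ū)` lies in the ball of
radius `L + 1`, then the projections of the `x_i`, `y_i` on the span of `z̄, ū` are `ε`-close to
`z_i`, `u_i`, the distances between the entries of `t̄` are `ε`-close to those of `t̄'`, and `t̄` lies
in the ball of radius `L + ε`. -/
structure IsModulus.{v} {n k : ℕ} (L : ℕ) (F : (Idx n k → Idx n k → ℝ) → ℝ) (f : ℝ → ℝ) (ε : ℝ) :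
    Prop where
  continuousOn : ContinuousOn f (Set.Icc 0 1)
  mapsTo : Set.MapsTo f (Set.Icc 0 1) (Set.Icc 0 1)
  close : ∀ (E E' : Type v) [NormedAddCommGroup E] [InnerProductSpace ℝ E] [CompleteSpace E]
    [NormedAddCommGroup E'] [InnerProductSpace ℝ E'] [CompleteSpace E']
    (x : Fin n ⊕ Fin k → E) (y : Fin n → E) (z : Fin n ⊕ Fin k → E) (w : Fin n → E)
    (t' : Idx n k → E'), InBall (L + 1) (concat x y z w) →
    F (gramOf (concat x y z w)) < f ε → F (gramOf t') = 0 →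
      (∀ i, ‖(paramSpan z w).starProjection (x i) - z i‖ < ε) ∧
      (∀ i, ‖(paramSpan z w).starProjection (y i) - w i‖ < ε) ∧
      (∀ p q, |‖concat x y z w p - concat x y z w q‖ - ‖t' p - t' q‖| < ε) ∧
      InBall (L + ε) (concat x y z w)

/-! ### The axiom scheme and the theory `T_N` -/

/-- The axiom `ψ_{φ,ε}` for the locus formula `φ` given by `F`, with `δ = 2 √(ε (L + 2))`; the letters
`z, u` are the parameters and all quantifiers range over the ball of radius `L + 1`.
As `d_N` is truncated at one, so is the distance prescribed to `x_i` for `i > n`. -/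
def Psi {n k : ℕ} (L : ℕ) (F : (Idx n k → Idx n k → ℝ) → ℝ) (f : ℝ → ℝ) (ε : ℝ)
    {M : Type u} [NormedAddCommGroup M] [InnerProductSpace ℝ M] (d : M → ℝ) : Prop :=
  let δ : ℝ := 2 * √(ε * (L + 2))
  ∀ (z : Fin n ⊕ Fin k → M) (u : Fin n → M), InBall (L + 1) z → InBall (L + 1) u →
    (∀ (x : Fin n ⊕ Fin k → M) (y : Fin n → M), InBall (L + 1) x → InBall (L + 1) y →
      (F (gramOf (concat x y z u)) ≥ f ε
      ∨ (∃ w : M, ‖w‖ ≤ L + 1 ∧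
          ∃ i : Fin n, d w ^ 2 ≥ ‖w - u i‖ ^ 2 + ‖y i - u i‖ ^ 2 + ε ^ 2)
      ∨ (∃ (i : Fin k) (j : Fin n),
          ‖x (.inr i) - y j‖ ^ 2 ≤ ‖x (.inr i) - z (.inr i)‖ ^ 2 + d (z (.inr i)) ^ 2 + ε ^ 2)
      ∨ (∃ i j : Fin n, j ≠ i ∧ ‖x (.inl i) - y j‖ ≤ ‖x (.inl i) - y i‖ - ε)
      ∨ (∃ i : Fin n,
          ‖x (.inl i) - z (.inl i)‖ ^ 2 + d (z (.inl i)) ^ 2 ≤ ‖x (.inl i) - y i‖ ^ 2 - ε ^ 2)))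
    ∨ ∃ (x : Fin n ⊕ Fin k → M) (y : Fin n → M), InBall (L + 1) x ∧ InBall (L + 1) y ∧
        F (gramOf (concat x y z u)) ≤ f ε
        ∧ (∀ i : Fin n, d (y i) ≤ δ)
        ∧ (∀ i : Fin n, |d (x (.inl i)) - ‖x (.inl i) - y i‖| ≤ 2 * δ)
        ∧ (∀ i : Fin k,
            |d (x (.inr i)) ^ 2 - min 1 (‖x (.inr i) - z (.inr i)‖ ^ 2 + d (z (.inr i)) ^ 2)|
              ≤ 4 * δ * L)

/-- `(M, d) ⊨ T_N`: it is a model of `T₀` and satisfies `ψ_{φ,ε}` for all locus formulas `φ`, all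
positive integers `L` bounding the configuration, all rational `ε ∈ (0,1)` and all admissible
choices of the function `f`. -/
def ModelsTN {M : Type u} [NormedAddCommGroup M] [InnerProductSpace ℝ M] [CompleteSpace M]
    (d : M → ℝ) : Prop :=
  ModelsT0 d ∧
  ∀ (n k L : ℕ) (G : Idx n k → Idx n k → ℝ), 0 < L → IsLocus.{u} L G →
  ∀ F : (Idx n k → Idx n k → ℝ) → ℝ, IsLocusFormula G F →
  ∀ ε : ℚ, 0 < ε → ε < 1 → ∀ f : ℝ → ℝ, IsModulus.{u} L F f ε → Psi L F f ε d

end GenericHilbert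

end

/-!
The axiom `Psi` is a disjunction. Suppose that its first alternative, (A), fails at the parameters
`z̄, ū`, as witnessed by `x̄, ȳ` in `M`; the second one, (B), has to be shown.
Let `K` be the span of `z̄, ū`. In the Hilbert space `M ⊕ M ⊕ ℝ`, which extends `M`, the vectors `σ a = (P_K a, a - P_K a, 0)` form a copy of `M` that agrees with `M` exactly over `K`
(`doubling`). Hence `σ x̄, σ ȳ, z̄, ū` has the same inner products as `x̄, ȳ, z̄, ū`, so that it still
satisfies the locus formula.

The extension gets the black points of `M` together with the points `σ yᵢ + s`, where `s = √(5ε)` is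
a displacement in the third direction; `truncDist` turns any such set into a model of `T₀`. The
displacement makes up for the error terms in the failure of (A), so that no new black point is closer
to a point `m` of `M` than `d m` (`le_norm_sub_newBlack`): the new model extends the old one. As
`s < δ`, the inequalities of (B) hold strictly for `σ x̄, σ ȳ`, with `K`-projections controlled by the
modulus `f` (`newDist_left`, `newDist_right`). Existential closedness yields tuples of `M` whose
inner products, distances and values of `d` converge to those of `σ x̄, σ ȳ`
(`IsExistentiallyClosedT0.exists_seq`), and strict inequalities between continuous expressions pass
to these tuples.
-/

open scoped RealInnerProductSpace
open Filter Topology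

noncomputable section

namespace GenericHilbert

universe u

/-! ### Truncated distances and models of `T₀` -/

section TruncDist

variable {E : Type u} [NormedAddCommGroup E]

/-- The distance to the set `S`, truncated at one; it is constantly one if `S` is empty. -/
def truncDist (S : Set E) (x : E) : ℝ := sInf (insert 1 ((fun b => ‖x - b‖) '' S))

lemma le_truncDist {S : Set E} {x : E} {c : ℝ} (h1 : c ≤ 1) (h : ∀ b ∈ S, c ≤ ‖x - b‖) :
    c ≤ truncDist S x := by
  refine le_csInf (Set.insert_nonempty _ _) ?_
  rintro _ (rfl | ⟨b, hb, rfl⟩)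
  exacts [h1, h b hb]

lemma truncDist_nonneg (S : Set E) (x : E) : 0 ≤ truncDist S x :=
  le_truncDist zero_le_one fun _ _ => norm_nonneg _

lemma bddBelow_truncDist (S : Set E) (x : E) :
    BddBelow (insert 1 ((fun b => ‖x - b‖) '' S)) := by
  refine ⟨0, ?_⟩
  rintro _ (rfl | ⟨b, -, rfl⟩)
  exacts [zero_le_one, norm_nonneg _]

lemma truncDist_le_one (S : Set E) (x : E) : truncDist S x ≤ 1 :=
  csInf_le (bddBelow_truncDist S x) (Set.mem_insert _ _)

lemma truncDist_le_norm_sub {S : Set E} (x : E) {b : E} (hb : b ∈ S) :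
    truncDist S x ≤ ‖x - b‖ :=
  csInf_le (bddBelow_truncDist S x) (Set.mem_insert_of_mem _ ⟨b, hb, rfl⟩)

lemma truncDist_eq_zero {S : Set E} {b : E} (hb : b ∈ S) : truncDist S b = 0 :=
  le_antisymm (by simpa using truncDist_le_norm_sub b hb) (truncDist_nonneg _ _)

lemma exists_norm_sub_lt_of_truncDist_lt_one {S : Set E} {x : E} (h : truncDist S x < 1) {η : ℝ}
    (hη : 0 < η) : ∃ b ∈ S, ‖x - b‖ < truncDist S x + η := by
  by_contra! hc
  have := le_truncDist (S := S) (x := x) (c := min 1 (truncDist S x + η)) (min_le_left _ _)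
    fun b hb => (min_le_right _ _).trans (hc b hb)
  rcases min_le_iff.1 this with h' | h' <;> linarith

lemma modelsT0_truncDist [InnerProductSpace ℝ E] [CompleteSpace E] (S : Set E) :
    ModelsT0 (truncDist S) where
  nonneg := truncDist_nonneg S
  le_one := truncDist_le_one S
  ax_witness x := by
    have hbdd : BddBelow (Set.range fun y => max |truncDist S x - ‖x - y‖| (truncDist S y)) :=
      ⟨0, by rintro _ ⟨y, rfl⟩; exact (abs_nonneg _).trans (le_max_left _ _)⟩
    have h0 : 0 ≤ ⨅ y, max |truncDist S x - ‖x - y‖| (truncDist S y) :=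
      Real.iInf_nonneg fun y => (abs_nonneg _).trans (le_max_left _ _)
    rcases (truncDist_le_one S x).eq_or_lt with h | h
    · rw [h] at h0 ⊢
      simpa using h0
    · have : ⨅ y, max |truncDist S x - ‖x - y‖| (truncDist S y) = 0 := by
        refine le_antisymm (le_of_forall_pos_le_add fun η hη => ?_) h0
        obtain ⟨b, hb, hlt⟩ := exists_norm_sub_lt_of_truncDist_lt_one h hη
        refine (ciInf_le hbdd b).trans ?_
        have hle := truncDist_le_norm_sub x hb
        rw [truncDist_eq_zero hb, zero_add]
        exact max_le (abs_le.2 ⟨by linarith, by linarith⟩) hη.le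
      rw [this]
      exact min_eq_right (le_max_right _ _)
  ax_lipschitz x y := by
    have : truncDist S y - ‖x - y‖ ≤ truncDist S x := by
      refine le_truncDist ?_ fun b hb => ?_
      · linarith [truncDist_le_one S y, norm_nonneg (x - y)]
      · have h1 := truncDist_le_norm_sub y hb
        have h2 := norm_sub_le_norm_sub_add_norm_sub y x b
        rw [norm_sub_rev y x] at h2
        linarith
    linarith

end TruncDist

namespace ModelsT0

variable {M : Type u} [NormedAddCommGroup M] [InnerProductSpace ℝ M] [CompleteSpace M] {d : M → ℝ}

lemma le_add_norm_sub (hd : ModelsT0 d) (x y : M) : d y ≤ d x + ‖x - y‖ := by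
  linarith [hd.ax_lipschitz x y]

lemma le_norm_sub (hd : ModelsT0 d) (x : M) {b : M} (hb : d b = 0) : d x ≤ ‖x - b‖ := by
  have := hd.le_add_norm_sub b x
  rwa [hb, zero_add, norm_sub_rev] at this

lemma continuous (hd : ModelsT0 d) : Continuous d := by
  refine (LipschitzWith.of_le_add fun x y => ?_).continuous
  rw [dist_comm, dist_eq_norm]
  exact hd.le_add_norm_sub y x

lemma exists_approx (hd : ModelsT0 d) {x : M} (hx : d x < 1) {η : ℝ} (hη : 0 < η) :
    ∃ y, ‖x - y‖ < d x + η ∧ d y < η := by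
  have hw := hd.ax_witness x
  have hpos : 0 < max (1 - d x) 0 := lt_max_of_lt_left (by linarith)
  have h0 : ⨅ y, max |d x - ‖x - y‖| (d y) = 0 := by
    rcases min_choice (max (1 - d x) 0) (⨅ y, max |d x - ‖x - y‖| (d y)) with h | h
    · linarith
    · rw [← h, hw]
  obtain ⟨y, hy⟩ := exists_lt_of_ciInf_lt (h0.trans_lt hη)
  obtain ⟨h1, h2⟩ := max_lt_iff.1 hy
  exact ⟨y, by linarith [(abs_lt.1 h1).1], h2⟩

/-- The witnesses in the axiom of `T₀` are only approximately black; completeness provides exact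
black points, as limits of iterated approximate witnesses. -/
lemma exists_black (hd : ModelsT0 d) {x : M} (hx : d x < 1) {η : ℝ} (hη : 0 < η) :
    ∃ b, d b = 0 ∧ ‖x - b‖ < d x + η := by
  -- After a first step of length less than `d x + r`, the steps have lengths below `2r / 2 ^ j`,
  -- hence add up to at most `4r`, and `5r < η`.
  set r : ℝ := min (η / 8) (1 / 2)
  have hr0 : 0 < r := by positivity
  have hrη : r ≤ η / 8 := min_le_left _ _
  have hr1 : r ≤ 1 / 2 := min_le_right _ _
  have hstep : ∀ (j : ℕ) (y : M), ∃ y' : M, d y < r / 2 ^ j →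
      ‖y - y'‖ < 2 * r / 2 ^ j ∧ d y' < r / 2 ^ (j + 1) := by
    intro j y
    by_cases hy : d y < r / 2 ^ j
    · have hj : r / 2 ^ j ≤ r := div_le_self hr0.le (one_le_pow₀ one_le_two)
      obtain ⟨y', h1, h2⟩ := hd.exists_approx (x := y) (by linarith)
        (η := r / 2 ^ (j + 1)) (by positivity)
      refine ⟨y', fun _ => ⟨h1.trans ?_, h2⟩⟩
      have : r / 2 ^ (j + 1) ≤ r / 2 ^ j :=
        div_le_div_of_nonneg_left hr0.le (by positivity)
          (pow_le_pow_right₀ one_le_two (Nat.le_succ j))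
      rw [mul_div_assoc]
      linarith
    · exact ⟨y, fun h => absurd h hy⟩
  choose g hg using hstep
  obtain ⟨y₀, hy₀, hdy₀⟩ := hd.exists_approx hx hr0
  let Y : ℕ → M := fun j => Nat.rec y₀ g j
  have hY : ∀ j, d (Y j) < r / 2 ^ j := by
    intro j
    induction j with
    | zero => simpa [Y] using hdy₀
    | succ j ih => exact (hg j (Y j) ih).2
  have hdist : ∀ j, dist (Y j) (Y (j + 1)) ≤ 4 * r / 2 / 2 ^ j := fun j => by
    rw [dist_eq_norm]
    refine (hg j (Y j) (hY j)).1.le.trans (le_of_eq ?_)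
    ring
  obtain ⟨b, hb⟩ := cauchySeq_tendsto_of_complete (cauchySeq_of_le_geometric_two hdist)
  have hfar := dist_le_of_le_geometric_two_of_tendsto₀ hdist hb
  refine ⟨b, ?_, ?_⟩
  · refine le_antisymm (le_of_tendsto_of_tendsto' ((hd.continuous.tendsto b).comp hb)
      (g := fun j : ℕ => r / 2 ^ j) ?_ fun j => (hY j).le) (hd.nonneg b)
    exact tendsto_const_nhds.div_atTop (tendsto_pow_atTop_atTop_of_one_lt one_lt_two)
  · have h2 : ‖y₀ - b‖ ≤ 4 * r := by rw [← dist_eq_norm]; exact hfar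
    have := norm_sub_le_norm_sub_add_norm_sub x y₀ b
    linarith

end ModelsT0

/-! ### Transfer from extensions to existentially closed models -/

/-- The values of finitely many quantifier-free formulas at a tuple in an extension are
approximated simultaneously by tuples of an existentially closed model. -/
lemma IsExistentiallyClosedT0.exists_approx {M H : Type u} [NormedAddCommGroup M]
    [InnerProductSpace ℝ M] [CompleteSpace M] [NormedAddCommGroup H] [InnerProductSpace ℝ H]
    [CompleteSpace H] {d : M → ℝ} (hec : IsExistentiallyClosedT0 d) {d' : H → ℝ} {e : M →ₗᵢ[ℝ] H}
    (hd' : ModelsT0 d') (he : IsExtension d d' e) {m l : ℕ} {ι : Type} [Fintype ι]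
    (φ : ι → QFFormula (Fin m ⊕ Fin l)) (a : Fin l → M) {R : ℕ} (hR : 0 < R) (b : Fin m → H)
    (hb : ∀ i, ‖b i‖ ≤ R) {η : ℝ} (hη : 0 < η) :
    ∃ b' : Fin m → M, (∀ i, ‖b' i‖ ≤ R) ∧
      ∀ j, |(φ j).eval d (Sum.elim b' a) - (φ j).eval d' (Sum.elim b (e ∘ a))| < η := by
  let c : ι → ℝ := fun j => (φ j).eval d' (Sum.elim b (e ∘ a))
  let E := Fintype.equivFin ι
  let g : C(Fin (Fintype.card ι) → ℝ, ℝ) :=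
    ⟨fun v => ∑ j, |v j - c (E.symm j)|, by fun_prop⟩
  obtain ⟨b', hb', hlt⟩ := hec.2 H d' e hd' he m l (.conn _ g fun j => φ (E.symm j)) a
    (fun _ => R) (fun _ => hR) b hb η hη
  refine ⟨b', hb', fun j => ?_⟩
  have h0 : QFFormula.eval d' (Sum.elim b (e ∘ a)) (.conn _ g fun j => φ (E.symm j)) = 0 := by
    simp [QFFormula.eval, g, c]
  rw [h0, zero_add] at hlt
  refine lt_of_le_of_lt ?_ hlt
  have := Finset.single_le_sum
    (f := fun i => |(φ (E.symm i)).eval d (Sum.elim b' a) - c (E.symm i)|)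
    (fun i _ => abs_nonneg _) (Finset.mem_univ (E j))
  simpa [QFFormula.eval, g, c] using this

/-- A tuple of an extension is the limit, as far as inner products, distances and values of `d_N`
are concerned, of tuples of an existentially closed model. -/
lemma IsExistentiallyClosedT0.exists_seq {M H : Type u} [NormedAddCommGroup M]
    [InnerProductSpace ℝ M] [CompleteSpace M] [NormedAddCommGroup H] [InnerProductSpace ℝ H]
    [CompleteSpace H] {d : M → ℝ} (hec : IsExistentiallyClosedT0 d) {d' : H → ℝ} {e : M →ₗᵢ[ℝ] H}
    (hd' : ModelsT0 d') (he : IsExtension d d' e) {α β : Type} [Fintype α] [Fintype β]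
    (a : β → M) {R : ℕ} (hR : 0 < R) (b : α → H) (hb : ∀ i, ‖b i‖ ≤ R) :
    ∃ b' : ℕ → α → M, (∀ j i, ‖b' j i‖ ≤ R) ∧
      (∀ p q, Tendsto (fun j => ⟪Sum.elim (b' j) a p, Sum.elim (b' j) a q⟫) atTop
        (𝓝 ⟪Sum.elim b (e ∘ a) p, Sum.elim b (e ∘ a) q⟫)) ∧
      (∀ p q, Tendsto (fun j => ‖Sum.elim (b' j) a p - Sum.elim (b' j) a q‖) atTop
        (𝓝 ‖Sum.elim b (e ∘ a) p - Sum.elim b (e ∘ a) q‖)) ∧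
      ∀ i, Tendsto (fun j => d (b' j i)) atTop (𝓝 (d' (b i))) := by
  let A := Fintype.equivFin α
  let B := Fintype.equivFin β
  let V := α ⊕ β
  let T : V → HTerm (Fin (Fintype.card α) ⊕ Fin (Fintype.card β)) := fun p => .var (Sum.map A B p)
  let φ : (V × V) ⊕ (V × V) ⊕ V → QFFormula (Fin (Fintype.card α) ⊕ Fin (Fintype.card β)) :=
    Sum.elim (fun p => .inner (T p.1) (T p.2))
      (Sum.elim (fun p => .dist (T p.1) (T p.2)) fun p => .dN (T p))
  have key := fun j : ℕ => hec.exists_approx hd' he φ (a ∘ B.symm) hR (b ∘ A.symm)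
    (fun i => hb _) (η := 1 / ((j : ℝ) + 1)) (by positivity)
  choose b' hb' happ using key
  have hlim : ∀ i, Tendsto (fun j => (φ i).eval d (Sum.elim (b' j) (a ∘ B.symm))) atTop
      (𝓝 ((φ i).eval d' (Sum.elim (b ∘ A.symm) (e ∘ a ∘ B.symm)))) := fun i => by
    rw [tendsto_iff_dist_tendsto_zero]
    exact squeeze_zero (fun _ => dist_nonneg) (fun j => (happ j i).le)
      tendsto_one_div_add_atTop_nhds_zero_nat
  have hM : ∀ j p, (T p).eval (Sum.elim (b' j) (a ∘ B.symm)) = Sum.elim (b' j ∘ A) a p := by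
    rintro j (p | p) <;> simp [T, HTerm.eval]
  have hH : ∀ p, (T p).eval (Sum.elim (b ∘ A.symm) (e ∘ a ∘ B.symm)) = Sum.elim b (e ∘ a) p := by
    rintro (p | p) <;> simp [T, HTerm.eval]
  refine ⟨fun j => b' j ∘ A, fun j i => hb' j _, fun p q => ?_, fun p q => ?_, fun i => ?_⟩
  · simpa only [φ, Sum.elim_inl, QFFormula.eval, hM, hH] using hlim (.inl (p, q))
  · simpa only [φ, Sum.elim_inl, Sum.elim_inr, QFFormula.eval, hM, hH] using
      hlim (.inr (.inl (p, q)))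
  · simpa only [φ, Sum.elim_inl, Sum.elim_inr, QFFormula.eval, hM, hH] using
      hlim (.inr (.inr (.inl i)))

/-! ### The amalgam of two copies of a Hilbert space over a subspace -/

section Amalgam

variable {M : Type u} [NormedAddCommGroup M] [InnerProductSpace ℝ M]

/-- The Hilbert sum of two copies of `M` and a line. -/
abbrev Amalgam (M : Type u) [NormedAddCommGroup M] [InnerProductSpace ℝ M] : Type u :=
  WithLp 2 (M × WithLp 2 (M × ℝ))

/-- The vector of `M ⊕ M ⊕ ℝ` with the given components. -/
def Amalgam.mk (a b : M) (s : ℝ) : Amalgam M := WithLp.toLp 2 (a, WithLp.toLp 2 (b, s))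

lemma Amalgam.norm_mk_sub_mk_sq (a b a' b' : M) (s s' : ℝ) :
    ‖mk a b s - mk a' b' s'‖ ^ 2 = ‖a - a'‖ ^ 2 + ‖b - b'‖ ^ 2 + (s - s') ^ 2 := by
  rw [WithLp.prod_norm_sq_eq_of_L2, WithLp.prod_norm_sq_eq_of_L2]
  simp [mk, add_assoc]

/-- `M` as the first summand of `M ⊕ M ⊕ ℝ`. -/
def baseEmb : M →ₗᵢ[ℝ] Amalgam M where
  toFun m := Amalgam.mk m 0 0
  map_add' a b := by simp [Amalgam.mk, ← WithLp.toLp_add]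
  map_smul' r a := by simp [Amalgam.mk, ← WithLp.toLp_smul]
  norm_map' a := by
    have h := Amalgam.norm_mk_sub_mk_sq a 0 0 0 0 0
    have h0 : Amalgam.mk (0 : M) 0 0 = 0 := rfl
    rw [h0] at h
    refine (pow_left_inj₀ (norm_nonneg _) (norm_nonneg _) two_ne_zero).1 ?_
    change ‖Amalgam.mk a 0 0‖ ^ 2 = _
    simpa using h

lemma norm_sub_sq_eq_starProjection (K : Submodule ℝ M) [K.HasOrthogonalProjection] (x : M) {z : M}
    (hz : z ∈ K) :
    ‖x - z‖ ^ 2 = ‖K.starProjection x - z‖ ^ 2 + ‖x - K.starProjection x‖ ^ 2 := by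
  have h : ⟪K.starProjection x - z, x - K.starProjection x⟫ = 0 := by
    rw [real_inner_comm]
    exact K.starProjection_inner_eq_zero x _
      (K.sub_mem (K.starProjection_apply_mem x) hz)
  have h2 := norm_add_sq_real (K.starProjection x - z) (x - K.starProjection x)
  rw [h, show K.starProjection x - z + (x - K.starProjection x) = x - z by abel] at h2
  linarith

/-- A copy of `M` in `M ⊕ M ⊕ ℝ`: the component in `K` stays in the first summand, the component
orthogonal to `K` is moved to the second one. -/
def doubling (K : Submodule ℝ M) [K.HasOrthogonalProjection] : M →ₗᵢ[ℝ] Amalgam M where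
  toFun a := Amalgam.mk (K.starProjection a) (a - K.starProjection a) 0
  map_add' a b := by
    simp only [Amalgam.mk, ← WithLp.toLp_add, Prod.mk_add_mk, map_add, add_zero]
    congr 4
    abel
  map_smul' r a := by
    simp [Amalgam.mk, ← WithLp.toLp_smul, smul_sub]
  norm_map' a := by
    have h := Amalgam.norm_mk_sub_mk_sq (K.starProjection a) (a - K.starProjection a) 0 0 0 0
    have h0 : Amalgam.mk (0 : M) 0 0 = 0 := rfl
    rw [h0] at h
    have h2 := norm_sub_sq_eq_starProjection K a K.zero_mem
    refine (pow_left_inj₀ (norm_nonneg _) (norm_nonneg _) two_ne_zero).1 ?_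
    simp only [sub_zero] at h h2
    change ‖Amalgam.mk (K.starProjection a) (a - K.starProjection a) 0‖ ^ 2 = _
    rw [h, h2]
    ring

/-- The vector `a` of the second copy of `M`, displaced by `s` along the line. -/
def displaced (K : Submodule ℝ M) [K.HasOrthogonalProjection] (s : ℝ) (a : M) : Amalgam M :=
  Amalgam.mk (K.starProjection a) (a - K.starProjection a) s

variable (K : Submodule ℝ M) [K.HasOrthogonalProjection]

lemma doubling_eq_baseEmb {z : M} (hz : z ∈ K) : doubling K z = baseEmb z := by
  change Amalgam.mk _ _ _ = Amalgam.mk _ _ _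
  rw [K.starProjection_eq_self_iff.2 hz, sub_self]

lemma norm_doubling_sub_baseEmb_sq (x m : M) :
    ‖doubling K x - baseEmb m‖ ^ 2
      = ‖K.starProjection x - m‖ ^ 2 + ‖x - K.starProjection x‖ ^ 2 := by
  refine (Amalgam.norm_mk_sub_mk_sq _ _ _ _ _ _).trans ?_
  simp

lemma norm_baseEmb_sub_displaced_sq (s : ℝ) (m y : M) :
    ‖baseEmb m - displaced K s y‖ ^ 2
      = ‖m - K.starProjection y‖ ^ 2 + ‖y - K.starProjection y‖ ^ 2 + s ^ 2 := by
  refine (Amalgam.norm_mk_sub_mk_sq _ _ _ _ _ _).trans ?_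
  rw [zero_sub, norm_neg, zero_sub, neg_sq]

lemma norm_doubling_sub_displaced_sq (s : ℝ) (x y : M) :
    ‖doubling K x - displaced K s y‖ ^ 2 = ‖x - y‖ ^ 2 + s ^ 2 := by
  have h1 : ‖doubling K x - displaced K s y‖ ^ 2 = _ := Amalgam.norm_mk_sub_mk_sq _ _ _ _ _ _
  have h2 : ‖doubling K x - doubling K y‖ ^ 2 = _ := Amalgam.norm_mk_sub_mk_sq _ _ _ _ _ _
  rw [← map_sub, LinearIsometry.norm_map] at h2
  rw [h1, h2]
  ring

lemma norm_sub_le_norm_doubling_sub_displaced (s : ℝ) (x y : M) :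
    ‖x - y‖ ≤ ‖doubling K x - displaced K s y‖ := by
  refine (pow_le_pow_iff_left₀ (norm_nonneg _) (norm_nonneg _) two_ne_zero).1 ?_
  rw [norm_doubling_sub_displaced_sq]
  linarith [sq_nonneg s]

lemma norm_doubling_sub_displaced_le {s : ℝ} (hs : 0 ≤ s) (x y : M) :
    ‖doubling K x - displaced K s y‖ ≤ ‖x - y‖ + s := by
  refine (pow_le_pow_iff_left₀ (norm_nonneg _) (by positivity) two_ne_zero).1 ?_
  rw [norm_doubling_sub_displaced_sq]
  nlinarith [mul_nonneg (norm_nonneg (x - y)) hs]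

/-! ### Distances to the black points -/

/-- The black points of the extension: those of `M`, and the displaced copies of the `yᵢ`. -/
def newBlack {ι : Type} (d : M → ℝ) (s : ℝ) (y : ι → M) : Set (Amalgam M) :=
  baseEmb '' {b | d b = 0} ∪ Set.range fun i => displaced K s (y i)

lemma baseEmb_mem_newBlack {ι : Type} {d : M → ℝ} (s : ℝ) (y : ι → M) {b : M} (hb : d b = 0) :
    baseEmb b ∈ newBlack K d s y :=
  Or.inl ⟨b, hb, rfl⟩

lemma displaced_mem_newBlack {ι : Type} (d : M → ℝ) (s : ℝ) (y : ι → M) (i : ι) :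
    displaced K s (y i) ∈ newBlack K d s y :=
  Or.inr ⟨i, rfl⟩

variable [CompleteSpace M] {d : M → ℝ}

/-- No new black point is closer to a point of `M` than the old ones. For points outside the ball of
radius `L + 1`, to which the hypothesis `h` does not apply, this holds because `y` has norm at
most `L + ε`. -/
lemma le_norm_sub_newBlack (hd : ModelsT0 d) {L ε s : ℝ} (hε1 : ε < 1) (hs : s ^ 2 = 5 * ε)
    {y u : M} (hu : u ∈ K) (hy : ‖y‖ ≤ L + ε) (hyu : ‖K.starProjection y - u‖ < ε)
    (h : ∀ w : M, ‖w‖ ≤ L + 1 → d w ^ 2 < ‖w - u‖ ^ 2 + ‖y - u‖ ^ 2 + ε ^ 2) (m : M) :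
    d m ≤ ‖baseEmb m - displaced K s y‖ := by
  refine (pow_le_pow_iff_left₀ (hd.nonneg m) (norm_nonneg _) two_ne_zero).1 ?_
  rw [norm_baseEmb_sub_displaced_sq, hs]
  have hd0 := hd.nonneg m
  have hd1 := hd.le_one m
  have ht0 := norm_nonneg (K.starProjection y - u)
  have hr0 := norm_nonneg (m - K.starProjection y)
  have hq0 := sq_nonneg ‖y - K.starProjection y‖
  by_cases hr1 : 1 ≤ ‖m - K.starProjection y‖
  · nlinarith
  push Not at hr1
  by_cases hm : ‖m‖ ≤ L + 1
  · have h1 := h m hm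
    have h2 := norm_sub_sq_eq_starProjection K y hu
    have h3 := norm_sub_le_norm_sub_add_norm_sub m (K.starProjection y) u
    have h4 := norm_nonneg (m - u)
    nlinarith
  · push Not at hm
    have h1 : ‖K.starProjection y‖ ≤ ‖y‖ := K.norm_starProjection_apply_le y
    have h2 := norm_sub_norm_le m (K.starProjection y)
    have h3 : 1 - ε ≤ ‖m - K.starProjection y‖ := by linarith
    nlinarith

/-- The distance from the new copy of `x` to an old black point. -/
lemma sq_add_sq_le_norm_doubling_sub_sq (hd : ModelsT0 d) {ε : ℝ} (hε1 : ε < 1) {x z b : M}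
    (hz : z ∈ K) (hxz : ‖K.starProjection x - z‖ < ε) (hb : d b = 0) :
    ‖x - z‖ ^ 2 + d z ^ 2 - 2 * ε ≤ ‖doubling K x - baseEmb b‖ ^ 2 := by
  rw [norm_doubling_sub_baseEmb_sq, norm_sub_sq_eq_starProjection K x hz]
  have h1 := hd.le_norm_sub z hb
  have h2 := norm_sub_le_norm_sub_add_norm_sub z (K.starProjection x) b
  rw [norm_sub_rev z (K.starProjection x)] at h2
  have hd0 := hd.nonneg z
  have hd1 := hd.le_one z
  have ht0 := norm_nonneg (K.starProjection x - z)
  have hr0 := norm_nonneg (K.starProjection x - b)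
  rcases le_total (d z) ‖K.starProjection x - z‖ with h | h
  · nlinarith
  · nlinarith

lemma isExtension_truncDist_newBlack (hd : ModelsT0 d) {ι : Type} {s : ℝ} {y : ι → M}
    (h : ∀ i m, d m ≤ ‖baseEmb m - displaced K s (y i)‖) :
    IsExtension d (truncDist (newBlack K d s y)) baseEmb := by
  intro m
  refine le_antisymm ?_ (le_truncDist (hd.le_one m) ?_)
  · rcases (hd.le_one m).eq_or_lt with h1 | h1
    · exact h1 ▸ truncDist_le_one _ _
    · refine le_of_forall_pos_le_add fun η hη => ?_
      obtain ⟨b, hb, hlt⟩ := hd.exists_black h1 hη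
      refine (truncDist_le_norm_sub _ (baseEmb_mem_newBlack K s y hb)).trans ?_
      rw [← map_sub, LinearIsometry.norm_map]
      exact hlt.le
  · rintro _ (⟨b, hb, rfl⟩ | ⟨i, rfl⟩)
    · rw [← map_sub, LinearIsometry.norm_map]
      exact hd.le_norm_sub m hb
    · exact h i m

variable {ι : Type} {s ε δ : ℝ} {y : ι → M}

/-- The distance from the new copy of `xᵢ`, `i ≤ n`, to the black points is approximately `‖xᵢ - yᵢ‖`:
neither the old black points nor the other new ones are essentially closer than that of `yᵢ`. -/
lemma newDist_left (hd : ModelsT0 d) (hε0 : 0 < ε) (hε1 : ε < 1) (hs : 0 ≤ s) (hsδ : s < δ)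
    (hδ : 4 * ε ≤ δ ^ 2) {x z : M} (i : ι) (hz : z ∈ K) (hxz : ‖K.starProjection x - z‖ < ε)
    (hεδ : ε ≤ δ) (hxy : ‖x - y i‖ ≤ 1 + ε) (hne : ∀ j, j ≠ i → ‖x - y i‖ - ε < ‖x - y j‖)
    (hold : ‖x - y i‖ ^ 2 - ε ^ 2 < ‖x - z‖ ^ 2 + d z ^ 2) :
    |truncDist (newBlack K d s y) (doubling K x) - ‖x - y i‖| < 2 * δ := by
  have hδ0 : 0 < δ := hs.trans_lt hsδ
  have hup : truncDist (newBlack K d s y) (doubling K x) ≤ ‖x - y i‖ + s :=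
    (truncDist_le_norm_sub _ (displaced_mem_newBlack K d s y i)).trans
      (norm_doubling_sub_displaced_le K hs x (y i))
  have hlow : ‖x - y i‖ - δ ≤ truncDist (newBlack K d s y) (doubling K x) := by
    refine le_truncDist (by linarith) ?_
    rintro _ (⟨b, hb, rfl⟩ | ⟨j, rfl⟩)
    · have h1 := sq_add_sq_le_norm_doubling_sub_sq K hd hε1 hz hxz hb
      by_contra! hc
      have h2 := norm_nonneg (doubling K x - baseEmb b)
      nlinarith
    · refine le_trans ?_ (norm_sub_le_norm_doubling_sub_displaced K s x (y j))
      rcases eq_or_ne j i with rfl | hj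
      · linarith
      · linarith [hne j hj]
  exact abs_lt.2 ⟨by linarith, by linarith⟩

/-- The distance from the new copy of `xᵢ`, `i > n`, to the black points is, up to truncation,
approximately the distance to the old ones. -/
lemma newDist_right (hd : ModelsT0 d) (hε0 : 0 < ε) (hε1 : ε < 1) {x z : M} (hz : z ∈ K)
    (hxz : ‖K.starProjection x - z‖ < ε)
    (hnew : ∀ j, ‖x - z‖ ^ 2 + d z ^ 2 + ε ^ 2 < ‖x - y j‖ ^ 2) :
    |truncDist (newBlack K d s y) (doubling K x) ^ 2 - min 1 (‖x - z‖ ^ 2 + d z ^ 2)|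
      ≤ 3 * ε := by
  set D := truncDist (newBlack K d s y) (doubling K x) with hD
  have hD0 : 0 ≤ D := truncDist_nonneg _ _
  have hD1 : D ≤ 1 := truncDist_le_one _ _
  set c := min 1 (‖x - z‖ ^ 2 + d z ^ 2) with hc
  have hc1 : c ≤ 1 := min_le_left _ _
  have hc2 : c ≤ ‖x - z‖ ^ 2 + d z ^ 2 := min_le_right _ _
  have hlow : c - 2 * ε ≤ D ^ 2 := by
    rcases le_total (c - 2 * ε) 0 with h0 | h0
    · exact h0.trans (sq_nonneg _)
    refine (Real.sqrt_le_left hD0).1 (le_truncDist ?_ ?_)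
    · exact Real.sqrt_le_one.2 (by linarith)
    · rintro _ (⟨b, hb, rfl⟩ | ⟨j, rfl⟩)
      · refine (Real.sqrt_le_left (norm_nonneg _)).2 ?_
        linarith [sq_add_sq_le_norm_doubling_sub_sq K hd hε1 hz hxz hb]
      · refine (Real.sqrt_le_left (norm_nonneg _)).2 ?_
        rw [norm_doubling_sub_displaced_sq]
        linarith [hnew j, sq_nonneg s, sq_nonneg ε]
  have hup : D ^ 2 ≤ c + 3 * ε := by
    rcases le_total 1 (‖x - z‖ ^ 2 + d z ^ 2) with h1 | h1
    · rw [hc, min_eq_left h1]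
      nlinarith
    rw [hc, min_eq_right h1]
    rcases (hd.le_one z).eq_or_lt with hz1 | hz1
    · rw [hz1]
      nlinarith [sq_nonneg ‖x - z‖]
    · obtain ⟨b, hb, hlt⟩ := hd.exists_black hz1 (sub_pos.2 hxz)
      have h2 : D ≤ ‖doubling K x - baseEmb b‖ :=
        truncDist_le_norm_sub _ (baseEmb_mem_newBlack K s y hb)
      have h3 := norm_doubling_sub_baseEmb_sq K x b
      have h4 := norm_sub_sq_eq_starProjection K x hz
      have h5 := norm_sub_le_norm_sub_add_norm_sub (K.starProjection x) z b
      have h6 : ‖K.starProjection x - b‖ ≤ d z + ε := by linarith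
      have h7 : ‖K.starProjection x - b‖ ^ 2 ≤ (d z + ε) ^ 2 :=
        pow_le_pow_left₀ (norm_nonneg _) h6 2
      have h8 : D ^ 2 ≤ ‖doubling K x - baseEmb b‖ ^ 2 := pow_le_pow_left₀ hD0 h2 2
      nlinarith [sq_nonneg ‖K.starProjection x - z‖, mul_le_mul_of_nonneg_right hz1.le hε0.le]
  exact abs_le.2 ⟨by linarith, by linarith⟩

end Amalgam

/-! ### The axioms of `T_N` in an existentially closed model -/

lemma concat_eq {n k : ℕ} {E : Type u} (x : Fin n ⊕ Fin k → E) (y : Fin n → E)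
    (z : Fin n ⊕ Fin k → E) (w : Fin n → E) (p : Idx n k) :
    concat x y z w p
      = Sum.elim (Sum.elim x y) (Sum.elim z w) ((Equiv.sumAssoc _ _ _).symm p) := by
  rcases p with p | p | p | p <;> rfl

/-- A locus is realised by a tuple with `‖xᵢ - yᵢ‖ ≤ 1` for `i ≤ n`, as `‖xᵢ - yᵢ‖` is a value of
`d_N`. -/
lemma IsLocus.exists_tuple {n k L : ℕ} {G : Idx n k → Idx n k → ℝ} (hG : IsLocus.{u} L G) :
    ∃ (E : Type u) (_ : NormedAddCommGroup E) (_ : InnerProductSpace ℝ E) (_ : CompleteSpace E)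
      (t : Idx n k → E), gramOf t = G ∧
      ∀ i : Fin n, ‖t (.inl (.inl i)) - t (.inr (.inl i))‖ ≤ 1 := by
  obtain ⟨M, M₁, _, _, _, _, _, _, d, d₁, e, x, y, z, w, -, hd₁, -, hconf, hGe⟩ := hG
  exact ⟨M₁, inferInstance, inferInstance, inferInstance, concat x y (e ∘ z) (e ∘ w), hGe.symm,
    fun i => (hconf.x_left i).symm.trans_le (hd₁.le_one _)⟩

lemma IsExistentiallyClosedT0.psi {M : Type u} [NormedAddCommGroup M] [InnerProductSpace ℝ M]
    [CompleteSpace M] {d : M → ℝ} (hec : IsExistentiallyClosedT0 d) {n k L : ℕ}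
    {G : Idx n k → Idx n k → ℝ} (hL : 0 < L) (hG : IsLocus.{u} L G)
    {F : (Idx n k → Idx n k → ℝ) → ℝ} (hF : IsLocusFormula G F) {ε : ℝ} (hε0 : 0 < ε) (hε1 : ε < 1)
    {f : ℝ → ℝ} (hf : IsModulus.{u} L F f ε) : Psi L F f ε d := by
  intro z u hz hu
  set δ : ℝ := 2 * √(ε * (L + 2)) with hδ
  rw [or_iff_not_imp_left]
  intro hA
  push Not at hA
  obtain ⟨x, y, hx, hy, hFlt, hA1, hA2, hA3, hA4⟩ := hA
  have hd := hec.1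
  obtain ⟨E', _, _, _, t', ht', ht1⟩ := hG.exists_tuple
  have hball : InBall ((L : ℝ) + 1) (concat x y z u) := by
    rintro (p | p | p | p)
    exacts [hx p, hy p, hz p, hu p]
  obtain ⟨hPx, hPy, hdist, hball'⟩ := hf.close M E' x y z u t' hball hFlt
    (by rw [ht']; exact (hF.eq_zero_iff G).2 rfl)
  set K := paramSpan z u
  have hzK : ∀ i, z i ∈ K := fun i => Submodule.subset_span (Or.inl ⟨i, rfl⟩)
  have huK : ∀ i, u i ∈ K := fun i => Submodule.subset_span (Or.inr ⟨i, rfl⟩)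
  -- The errors in the negated first alternative amount to at most `5ε`, and `5ε < 12ε ≤ δ²`.
  set s : ℝ := √(5 * ε)
  have hL1 : (1 : ℝ) ≤ L := by exact_mod_cast hL
  have hs0 : 0 ≤ s := Real.sqrt_nonneg _
  have hs2 : s ^ 2 = 5 * ε := Real.sq_sqrt (by positivity)
  have hδ0 : 0 ≤ δ := by positivity
  have hδ2 : δ ^ 2 = 4 * (ε * (L + 2)) := by
    rw [hδ, mul_pow, Real.sq_sqrt (by positivity)]
    norm_num
  have hδ3 : 12 * ε ≤ δ ^ 2 := by rw [hδ2]; nlinarith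
  have hsδ : s < δ := lt_of_pow_lt_pow_left₀ 2 hδ0 (by linarith)
  have hεδ : ε ≤ δ := (pow_le_pow_iff_left₀ hε0.le hδ0 two_ne_zero).1 (by nlinarith)
  set d' := truncDist (newBlack K d s y) with hd'
  have hext : IsExtension d d' baseEmb := isExtension_truncDist_newBlack K hd fun i m =>
    le_norm_sub_newBlack K hd hε1 hs2 (huK i) (hball' (.inr (.inl i))) (hPy i)
      (fun w hw => hA1 w hw i) m
  obtain ⟨b, hbR, hinner, hnorm, hdN⟩ := hec.exists_seq (modelsT0_truncDist _) hext
    (Sum.elim z u) (R := L + 1) (Nat.succ_pos L)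
    (Sum.elim (doubling K ∘ x) (doubling K ∘ y)) (by
      rintro (i | i)
      · simpa using hx i
      · simpa using hy i)
  set X : ℕ → Fin n ⊕ Fin k → M := fun j i => b j (.inl i)
  set Y : ℕ → Fin n → M := fun j i => b j (.inr i)
  have hb : ∀ j, b j = Sum.elim (X j) (Y j) := fun j => by
    ext (i | i) <;> rfl
  -- As the two copies of `M` agree on `K`, all vectors in question lie in the second copy.
  have hV : ∀ p, Sum.elim (Sum.elim (doubling K ∘ x) (doubling K ∘ y)) (baseEmb ∘ Sum.elim z u) p
      = doubling K (Sum.elim (Sum.elim x y) (Sum.elim z u) p) := by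
    rintro ((i | i) | (i | i))
    exacts [rfl, rfl, (doubling_eq_baseEmb K (hzK i)).symm, (doubling_eq_baseEmb K (huK i)).symm]
  simp only [hV, ← map_sub, LinearIsometry.inner_map_map, LinearIsometry.norm_map] at hinner hnorm
  have hgram : Tendsto (fun j => F (gramOf (concat (X j) (Y j) z u))) atTop
      (𝓝 (F (gramOf (concat x y z u)))) := by
    refine (hF.continuous.tendsto _).comp (tendsto_pi_nhds.2 fun p => tendsto_pi_nhds.2 fun q => ?_)
    simpa only [gramOf, concat_eq, ← hb] using hinner _ _
  have hdx : ∀ i, Tendsto (fun j => d (X j i)) atTop (𝓝 (d' (doubling K (x i)))) :=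
    fun i => hdN (.inl i)
  have hdy : ∀ i, Tendsto (fun j => d (Y j i)) atTop (𝓝 (d' (doubling K (y i)))) :=
    fun i => hdN (.inr i)
  have hxy : ∀ i : Fin n, Tendsto (fun j => ‖X j (.inl i) - Y j i‖) atTop
      (𝓝 ‖x (.inl i) - y i‖) := fun i => hnorm (.inl (.inl (.inl i))) (.inl (.inr i))
  have hxz : ∀ i, Tendsto (fun j => ‖X j i - z i‖) atTop (𝓝 ‖x i - z i‖) :=
    fun i => hnorm (.inl (.inl i)) (.inr (.inl i))
  have ev1 := hgram.eventually_lt_const hFlt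
  have ev2 : ∀ i, ∀ᶠ j in atTop, d (Y j i) < δ := fun i => by
    refine (hdy i).eventually_lt_const (lt_of_le_of_lt ?_ hsδ)
    refine (truncDist_le_norm_sub _ (displaced_mem_newBlack K d s y i)).trans ?_
    simpa using norm_doubling_sub_displaced_le K hs0 (y i) (y i)
  have ev3 : ∀ i : Fin n, ∀ᶠ j in atTop, |d (X j (.inl i)) - ‖X j (.inl i) - Y j i‖| < 2 * δ :=
    fun i => by
    refine ((hdx (.inl i)).sub (hxy i)).abs.eventually_lt_const ?_
    have h1 : |‖x (.inl i) - y i‖ - _| < ε := hdist (.inl (.inl i)) (.inr (.inl i))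
    exact newDist_left K hd hε0 hε1 hs0 hsδ (by linarith) i (hzK _) (hPx _) hεδ
      (by linarith [(abs_lt.1 h1).2, ht1 i]) (fun j hj => hA3 i j hj) (hA4 i)
  have ev4 : ∀ i : Fin k, ∀ᶠ j in atTop, |d (X j (.inr i)) ^ 2 -
      min 1 (‖X j (.inr i) - z (.inr i)‖ ^ 2 + d (z (.inr i)) ^ 2)| < 4 * δ * L := fun i => by
    refine (((hdx (.inr i)).pow 2).sub (tendsto_const_nhds.min
      (((hxz (.inr i)).pow 2).add_const _))).abs.eventually_lt_const ?_
    refine (newDist_right K hd hε0 hε1 (hzK _) (hPx _) fun j => hA2 i j).trans_lt ?_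
    nlinarith
  obtain ⟨j, h1, h2, h3, h4⟩ := (ev1.and ((eventually_all.2 ev2).and
    ((eventually_all.2 ev3).and (eventually_all.2 ev4)))).exists
  have hR : ∀ i, ‖b j i‖ ≤ L + 1 := fun i => by exact_mod_cast hbR j i
  exact ⟨X j, Y j, fun i => hR _, fun i => hR _, h1.le, fun i => (h2 i).le, fun i => (h3 i).le,
    fun i => (h4 i).le⟩

end GenericHilbert

end

/-- Every existentially closed model of `T₀` is a model of `T_N`. -/
theorem mainTheorem1 {M : Type*} [NormedAddCommGroup M] [InnerProductSpace ℝ M] [CompleteSpace M]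
    (d : M → ℝ) (hec : GenericHilbert.IsExistentiallyClosedT0 d) :
    GenericHilbert.ModelsTN d :=
  ⟨hec.1, fun _ _ _ _ hL hG _ hF _ hε0 hε1 _ hf =>
    hec.psi hL hG hF (by exact_mod_cast hε0) (by exact_mod_cast hε1) hf⟩
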